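/- Let $k\ge 1$ be an integer and let $G$ be a finite simple graph of order $n$, where $$n\ \ge\ \max\left\{\tfrac12 k^3+k+\tfrac52,\ 6k+5\right\}.$$ Let $\delta(G)$ denote the minimum degree of $G$ and let $\lambda(G)$ denote the spectral radius of $G$, i.e. the largest eigenvalue of its adjacency matrix. If $\delta(G)\ge k$ and $\lambda(G)\ge n-k-1$, then $G$ is Hamiltonian (it contains a spanning cycle), unless $G$ is isomorphic to $K_1\vee(K_k+K_{n-k-1})$ or to $K_k\vee(K_{n-2k}+kK_1)$. Here $+$ denotes the disjoint union of graphs, $\vee$ denotes the join (the disjoint union together with all edges between the two graphs), and $kK_1$ is the graph with $k$ vertices and no edges. -/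

import Mathlib

/-- The adjacency matrix of a finite graph over `ℝ` is Hermitian (i.e. real symmetric). -/
theorem adjMatrix_real_isHermitian {V : Type*} [Fintype V] [DecidableEq V]
    (G : SimpleGraph V) [DecidableRel G.Adj] : (G.adjMatrix ℝ).IsHermitian := by
  rw [Matrix.IsHermitian, Matrix.conjTranspose_eq_transpose_of_trivial]
  exact G.isSymm_adjMatrix

/-- The spectral radius `λ(G) = λ₁(G)` of a finite graph: the largest eigenvalue of its
(real symmetric) adjacency matrix. The index set is finite, so for a graph with at least one vertex
this supremum is a maximum. -/
noncomputable def graphSpectralRadius {V : Type*} [Fintype V] [DecidableEq V]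
    (G : SimpleGraph V) [DecidableRel G.Adj] : ℝ :=
  ⨆ i : V, (adjMatrix_real_isHermitian G).eigenvalues i

/-- The join `G ∨ H`: the disjoint union of `G` and `H` together with all edges between them. -/
def graphJoin {V W : Type*} (G : SimpleGraph V) (H : SimpleGraph W) : SimpleGraph (V ⊕ W) :=
  (G ⊕g H) ⊔ completeBipartiteGraph V W

/-- The graph `L_n^k = K_1 ∨ (K_k + K_{n-k-1})`; it has order `n` when `k + 1 ≤ n`. -/
def graphL (n k : ℕ) : SimpleGraph (Fin 1 ⊕ (Fin k ⊕ Fin (n - k - 1))) :=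
  graphJoin (SimpleGraph.completeGraph (Fin 1)) (SimpleGraph.completeGraph (Fin k) ⊕g SimpleGraph.completeGraph (Fin (n - k - 1)))

/-- The graph `N_n^k = K_k ∨ (K_{n-2k} + k K_1)`, where `k K_1` is the edgeless graph on `k`
vertices; it has order `n` when `2 * k ≤ n`. -/
def graphN (n k : ℕ) : SimpleGraph (Fin k ⊕ (Fin (n - 2 * k) ⊕ Fin k)) :=
  graphJoin (SimpleGraph.completeGraph (Fin k)) (SimpleGraph.completeGraph (Fin (n - 2 * k)) ⊕g SimpleGraph.emptyGraph (Fin k))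

/-!
Suppose `G` is not Hamiltonian, and let `H ≥ G` be an edge-maximal non-Hamiltonian graph. Adding
any missing edge `uv` to `H` creates a Hamiltonian cycle, so `H` has a Hamiltonian path from `u` to
`v`, and Ore's rotation argument gives `d(u) + d(v) < n` (`exists_maximal_not_isHamiltonian`).

The spectral hypothesis forces `2 e(G) ≥ n² - (2k + 1) n + 2k² + k`
(`le_sum_degree_of_le_graphSpectralRadius`), because every column sum of `A² - (k - 1) A` is at most
`2 e(G) - k (n - 1)`. This is so close to the extremal number of edges that a degree count in the
style of Chvátal's theorem determines `H` almost completely: `k` vertices, forming a set `A`, have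
degree `k`, and all other vertices form a clique (`exists_compl_clique`).

As `G` has minimum degree at least `k`, it has every edge of `H` that meets `A`. If it lacked an
edge of the clique, then explicit positive weights `y` with `A(G) y < (n - k - 1) y` would
contradict the spectral hypothesis (`graphSpectralRadius_lt_of_not_adj`); the bound
`n ≥ k³/2 + k + 5/2` is what makes these weights exist. Hence `G = H`.

Finally let `X` be the set of clique vertices with a neighbour in `A`; by Ore's condition they are
joined to all of `A`, and `A` induces a regular graph of degree `k - |X|`. If `|X| = 1` the graph is
`K_1 ∨ (K_k + K_{n-k-1})`, if `|X| = k` it is `K_k ∨ (K_{n-2k} + k K_1)`, and otherwise Dirac's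
theorem on `A` together with all but one vertex of `X` yields a Hamiltonian cycle
(`isHamiltonian_of_two_le_card_lt`).

In both spectral steps the Perron vector is replaced by the absolute value `z` of an eigenvector,
which satisfies `r z ≤ A z` (`exists_nonneg_subeigenvector`).
-/

/-! ### Hamiltonian cycles and the Ore closure -/

/-- A list enumerating every vertex exactly once, along edges and closing up, is a Hamiltonian
cycle. -/
theorem isHamiltonian_of_list {V : Type*} [Fintype V] [DecidableEq V] {G : SimpleGraph V}
    (hV : 3 ≤ Fintype.card V) (l : List V) (hne : l ≠ []) (hnd : l.Nodup) (hmem : ∀ v, v ∈ l)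
    (hch : l.IsChain G.Adj) (hcl : G.Adj (l.getLast hne) (l.head hne)) : G.IsHamiltonian := by
  intro _
  set p := SimpleGraph.Walk.ofSupport l hne hch with hp
  have hs : p.support = l := SimpleGraph.Walk.support_ofSupport hne hch
  have hpath : p.IsPath := SimpleGraph.Walk.IsPath.mk' (hs.symm ▸ hnd)
  have hham : p.IsHamiltonian := hpath.isHamiltonian_of_mem (fun w => hs.symm ▸ hmem w)
  refine ⟨_, SimpleGraph.Walk.cons hcl p, ?_, ?_⟩
  · rw [SimpleGraph.Walk.cons_isCycle_iff]
    refine ⟨hpath, fun h => ?_⟩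
    rw [Sym2.eq_swap] at h
    have := hpath.length_eq_one_of_mem_edges h
    have := hham.length_eq
    omega
  · intro a
    simpa using hham a

/-- Rotating a Hamiltonian cycle of `H + uv` so that it ends with the edge `uv` leaves a
Hamiltonian path of `H`. -/
theorem exists_hamiltonian_path_of_sup_edge {V : Type*} [Fintype V] [DecidableEq V]
    {H : SimpleGraph V} {u v : V} (huv : u ≠ v) (hH : ¬ H.IsHamiltonian)
    (hHe : (H ⊔ SimpleGraph.edge u v).IsHamiltonian) :
    ∃ p : H.Walk u v, p.IsHamiltonian := by
  have hnt : Nontrivial V := ⟨u, v, huv⟩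
  -- a cycle whose first edge is `uv` becomes a path of `H` once that edge is dropped
  have key : ∀ c : (H ⊔ SimpleGraph.edge u v).Walk u u, c.IsHamiltonianCycle → c.snd = v →
      ∃ p : H.Walk u v, p.IsHamiltonian := by
    intro c hc hsnd
    cases c with
    | nil => exact absurd rfl hc.isCycle.ne_nil
    | cons h q =>
      simp only [SimpleGraph.Walk.snd_cons] at hsnd
      subst hsnd
      have hq := (SimpleGraph.Walk.cons_isCycle_iff _ _).1 hc.isCycle
      have hqe : ∀ e ∈ q.edges, e ∈ H.edgeSet := by
        intro e he
        have h1 := q.edges_subset_edgeSet he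
        rw [SimpleGraph.edgeSet_sup] at h1
        rcases h1 with h1 | h1
        · exact h1
        · have := SimpleGraph.edgeSet_edge_subset h1
          exact absurd (this ▸ he) hq.2
      refine ⟨(q.transfer H hqe).reverse, fun a => ?_⟩
      have := hc.isHamiltonian_tail a
      simpa using this
  obtain ⟨c, hc⟩ := hHe.exists_isHamiltonianCycle u
  by_cases he : s(u, v) ∈ c.edges
  · have h1 : v ∈ c.toSubgraph.neighborSet u := by
      rw [SimpleGraph.Subgraph.mem_neighborSet, ← SimpleGraph.Subgraph.mem_edgeSet,
        SimpleGraph.Walk.mem_edges_toSubgraph]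
      exact he
    rw [hc.isCycle.neighborSet_toSubgraph_endpoint] at h1
    rcases h1 with h1 | h1
    · exact key c hc h1.symm
    · refine key c.reverse ?_ (by simpa using h1.symm)
      rw [SimpleGraph.Walk.isHamiltonianCycle_iff_isCycle_and_length_eq] at hc ⊢
      exact ⟨hc.1.reverse, by simpa using hc.2⟩
  · exfalso
    apply hH
    intro _
    have hce : ∀ e ∈ c.edges, e ∈ H.edgeSet := by
      intro e he'
      have h1 := c.edges_subset_edgeSet he'
      rw [SimpleGraph.edgeSet_sup] at h1
      rcases h1 with h1 | h1
      · exact h1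
      · have := SimpleGraph.edgeSet_edge_subset h1
        exact absurd (this ▸ he') he
    refine ⟨u, c.transfer H hce, ?_⟩
    rw [SimpleGraph.Walk.isHamiltonianCycle_iff_isCycle_and_length_eq] at hc ⊢
    exact ⟨hc.1.transfer hce, by simpa using hc.2⟩

/-- Ore's rotation argument: if a non-Hamiltonian graph has a Hamiltonian path
`p₀ = u, …, p_{n-1} = v`, then no `i` satisfies both `u ~ p_{i+1}` and `v ~ p_i`. -/
theorem degree_add_degree_lt_of_hamiltonian_path {V : Type*} [Fintype V] [DecidableEq V]
    {H : SimpleGraph V} [DecidableRel H.Adj] (hV : 3 ≤ Fintype.card V) {u v : V}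
    (hH : ¬ H.IsHamiltonian) (p : H.Walk u v) (hp : p.IsHamiltonian) :
    H.degree u + H.degree v < Fintype.card V := by
  have hlen := hp.length_eq
  set l := p.support with hl
  have hllen : l.length = Fintype.card V := hp.length_support
  have hnd : l.Nodup := hp.isPath.support_nodup
  have hch : l.IsChain H.Adj := p.isChain_adj_support
  have hmem : ∀ w, w ∈ l := hp.mem_support
  have h0 : p.getVert 0 = u := by simp
  have hlast : p.getVert (Fintype.card V - 1) = v := by rw [← hlen]; simp
  have hsurj : ∀ w, ∃ i < Fintype.card V, p.getVert i = w := by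
    intro w
    obtain ⟨i, hi, hi'⟩ := SimpleGraph.Walk.mem_support_iff_exists_getVert.1 (hmem w)
    exact ⟨i, by omega, hi⟩
  set n := Fintype.card V with hn
  set S := (Finset.range (n - 1)).filter fun i => H.Adj u (p.getVert (i + 1)) with hS
  set T := (Finset.range (n - 1)).filter fun i => H.Adj v (p.getVert i) with hT
  have hSu : H.degree u ≤ S.card := by
    rw [← SimpleGraph.card_neighborFinset_eq_degree]
    refine (Finset.card_le_card ?_).trans
      (Finset.card_image_le (s := S) (f := fun i => p.getVert (i + 1)))
    intro w hw
    rw [SimpleGraph.mem_neighborFinset] at hw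
    obtain ⟨i, hi, rfl⟩ := hsurj w
    have hi0 : i ≠ 0 := by rintro rfl; rw [h0] at hw; exact hw.ne rfl
    obtain ⟨j, rfl⟩ := Nat.exists_eq_succ_of_ne_zero hi0
    exact Finset.mem_image.2 ⟨j, Finset.mem_filter.2 ⟨Finset.mem_range.2 (by omega), hw⟩, rfl⟩
  have hTv : H.degree v ≤ T.card := by
    rw [← SimpleGraph.card_neighborFinset_eq_degree]
    refine (Finset.card_le_card ?_).trans
      (Finset.card_image_le (s := T) (f := fun i => p.getVert i))
    intro w hw
    rw [SimpleGraph.mem_neighborFinset] at hw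
    obtain ⟨i, hi, rfl⟩ := hsurj w
    have hi0 : i ≠ n - 1 := by rintro rfl; rw [hlast] at hw; exact hw.ne rfl
    exact Finset.mem_image.2 ⟨i, Finset.mem_filter.2 ⟨Finset.mem_range.2 (by omega), hw⟩, rfl⟩
  have hdisj : Disjoint S T := by
    rw [Finset.disjoint_left]
    intro i hiS hiT
    obtain ⟨hi, hiu⟩ := Finset.mem_filter.1 hiS
    obtain ⟨-, hiv⟩ := Finset.mem_filter.1 hiT
    rw [Finset.mem_range] at hi
    apply hH
    have hgv : ∀ j (hj : j < l.length), p.getVert j = l[j] := fun j hj =>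
      p.getVert_eq_support_getElem (by omega)
    have e1 : l.take (i + 1) ≠ [] := by
      intro h; have := congrArg List.length h; simp at this; simp [this] at hllen; omega
    have e2 : (l.drop (i + 1)).reverse ≠ [] := by
      intro h; have := congrArg List.length h; simp at this; omega
    have hl0 : l[0]'(by omega) = u := by rw [← hgv 0 (by omega), h0]
    have hll : l[n - 1]'(by omega) = v := by rw [← hgv _ (by omega), hlast]
    rw [hgv _ (by omega)] at hiu hiv
    have hperm : (l.take (i + 1) ++ (l.drop (i + 1)).reverse).Perm l := by
      conv_rhs => rw [← List.take_append_drop (i + 1) l]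
      exact List.Perm.append_left _ (List.reverse_perm _)
    refine isHamiltonian_of_list hV (l.take (i + 1) ++ (l.drop (i + 1)).reverse) (by simp [e1])
      (hperm.nodup_iff.2 hnd) (fun w => hperm.mem_iff.2 (hmem w)) ?_ ?_
    · refine List.IsChain.append (hch.take _) ?_ ?_
      · rw [List.isChain_reverse]
        exact (hch.drop _).imp fun _ _ h => h.symm
      · intro x hx y hy
        have hx' : x = l[i] := by
          rw [List.getLast?_take, if_neg (by omega), Nat.add_sub_cancel,
            List.getElem?_eq_getElem (by omega)] at hx
          simpa using hx.symm
        have hy' : y = v := by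
          rw [List.head?_reverse, List.getLast?_drop, if_neg (by omega),
            List.getLast?_eq_getElem?, List.getElem?_eq_getElem (by omega)] at hy
          rw [← hll]
          simp only [Option.mem_def, Option.some.injEq] at hy
          rw [← hy]; congr 1; omega
        rw [hx', hy']; exact hiv.symm
    · have a1 : (l.take (i + 1) ++ (l.drop (i + 1)).reverse).getLast (by simp [e1]) = l[i + 1] := by
        rw [List.getLast_append_of_ne_nil _ e2, List.getLast_reverse, List.head_drop]
      have a2 : (l.take (i + 1) ++ (l.drop (i + 1)).reverse).head (by simp [e1]) = u := by
        rw [List.head_append_of_ne_nil e1, List.head_take, ← hl0, List.head_eq_getElem]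
      rw [a1, a2]; exact hiu.symm
  have := Finset.card_le_card (Finset.union_subset (Finset.filter_subset _ _)
    (Finset.filter_subset _ _) : S ∪ T ⊆ Finset.range (n - 1))
  rw [Finset.card_union_of_disjoint hdisj, Finset.card_range] at this
  omega

theorem isHamiltonian_top {V : Type*} [Fintype V] [DecidableEq V] (hV : 3 ≤ Fintype.card V) :
    (⊤ : SimpleGraph V).IsHamiltonian := by
  have hnd : (Finset.univ : Finset V).toList.Nodup := Finset.nodup_toList _
  have hlen : (Finset.univ : Finset V).toList.length = Fintype.card V := by simp
  have hne : (Finset.univ : Finset V).toList ≠ [] := by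
    intro h; rw [h] at hlen; simp at hlen; omega
  refine isHamiltonian_of_list hV _ hne hnd (by simp) ?_ ?_
  · exact (List.Pairwise.isChain hnd).imp fun _ _ h => h
  · rw [SimpleGraph.top_adj, List.getLast_eq_getElem, List.head_eq_getElem]
    intro h
    have := (List.Nodup.getElem_inj_iff hnd).1 h
    omega

/-- Every non-Hamiltonian graph lies in one that is closed under Ore's condition: non-adjacent
vertices have degree sum less than the order. An edge-maximal non-Hamiltonian graph will do. -/
theorem exists_maximal_not_isHamiltonian {V : Type*} [Fintype V] [DecidableEq V]
    (hV : 3 ≤ Fintype.card V) {G : SimpleGraph V} (hG : ¬ G.IsHamiltonian) :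
    ∃ (H : SimpleGraph V) (_ : DecidableRel H.Adj), G ≤ H ∧ ¬ H.IsHamiltonian ∧
      ∀ u v, u ≠ v → ¬ H.Adj u v → H.degree u + H.degree v < Fintype.card V := by
  classical
  obtain ⟨H, hGH, hH⟩ := (Set.toFinite {H : SimpleGraph V | ¬ H.IsHamiltonian}).exists_le_maximal
    (show G ∈ {H : SimpleGraph V | ¬ H.IsHamiltonian} from hG)
  refine ⟨H, inferInstance, hGH, hH.prop, fun u v huv hadj => ?_⟩
  have hHe : (H ⊔ SimpleGraph.edge u v).IsHamiltonian := by
    by_contra hcon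
    have := hH.le_of_ge hcon le_sup_left
    exact hadj (this (Or.inr (by simp [SimpleGraph.edge_adj, huv])))
  obtain ⟨p, hp⟩ := exists_hamiltonian_path_of_sup_edge huv hH.prop hHe
  exact degree_add_degree_lt_of_hamiltonian_path hV hH.prop p hp

/-- Dirac's theorem. -/
theorem isHamiltonian_of_card_le_two_mul_degree {V : Type*} [Fintype V] [DecidableEq V]
    (hV : 3 ≤ Fintype.card V) {G : SimpleGraph V} [DecidableRel G.Adj]
    (hdeg : ∀ v, Fintype.card V ≤ 2 * G.degree v) : G.IsHamiltonian := by
  by_contra hG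
  obtain ⟨H, hdec, hGH, hH, hore⟩ := exists_maximal_not_isHamiltonian hV hG
  apply hH
  have : H = ⊤ := by
    ext u v
    rw [SimpleGraph.top_adj]
    refine ⟨fun h => h.ne, fun huv => ?_⟩
    by_contra hadj
    have h1 := hore u v huv hadj
    have h2 := SimpleGraph.degree_le_of_le (v := u) hGH
    have h3 := SimpleGraph.degree_le_of_le (v := v) hGH
    have h4 := hdeg u
    have h5 := hdeg v
    omega
  rw [this]
  exact isHamiltonian_top hV

/-! ### The spectral radius and the number of edges -/

theorem sum_mul_sum_neighborFinset_comm {V : Type*} [Fintype V] [DecidableEq V]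
    (G : SimpleGraph V) [DecidableRel G.Adj] (f g : V → ℝ) :
    ∑ v, f v * ∑ u ∈ G.neighborFinset v, g u = ∑ v, g v * ∑ u ∈ G.neighborFinset v, f u := by
  simp_rw [Finset.mul_sum, SimpleGraph.neighborFinset_eq_filter, Finset.sum_filter]
  rw [Finset.sum_comm]
  refine Finset.sum_congr rfl fun v _ => Finset.sum_congr rfl fun u _ => ?_
  simp only [G.adj_comm u v, mul_comm (f u)]

/-- A substitute for the Perron vector: the entrywise absolute value `z` of an eigenvector for the
largest eigenvalue `r` satisfies `r z ≤ A z`. -/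
theorem exists_nonneg_subeigenvector {V : Type*} [Fintype V] [DecidableEq V] [Nonempty V]
    (G : SimpleGraph V) [DecidableRel G.Adj] :
    ∃ z : V → ℝ, (∀ v, 0 ≤ z v) ∧ (∃ v, 0 < z v) ∧
      ∀ v, graphSpectralRadius G * z v ≤ ∑ u ∈ G.neighborFinset v, z u := by
  set hA := adjMatrix_real_isHermitian G
  obtain ⟨i, hi⟩ := exists_eq_ciSup_of_finite (f := hA.eigenvalues)
  have hr : graphSpectralRadius G = hA.eigenvalues i := hi.symm
  set x := hA.eigenvectorBasis i with hx
  refine ⟨fun v => |x v|, fun v => abs_nonneg _, ?_, fun v => ?_⟩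
  · by_contra! h
    apply hA.eigenvectorBasis.orthonormal.ne_zero i
    ext v
    have := h v
    simpa using this
  · have h1 := congrFun (hA.mulVec_eigenvectorBasis i) v
    rw [SimpleGraph.adjMatrix_mulVec_apply] at h1
    simp only [Pi.smul_apply, smul_eq_mul] at h1
    calc graphSpectralRadius G * |x v| ≤ |graphSpectralRadius G| * |x v| :=
          mul_le_mul_of_nonneg_right (le_abs_self _) (abs_nonneg _)
      _ = |∑ u ∈ G.neighborFinset v, x u| := by rw [← abs_mul, hr, ← h1]
      _ ≤ _ := Finset.abs_sum_le_sum_abs _ _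

/-- The Collatz–Wielandt upper bound for the spectral radius. -/
theorem graphSpectralRadius_lt_of_sum_lt {V : Type*} [Fintype V] [DecidableEq V] [Nonempty V]
    (G : SimpleGraph V) [DecidableRel G.Adj] (y : V → ℝ) (μ : ℝ) (hy : ∀ v, 0 < y v)
    (h : ∀ v, ∑ u ∈ G.neighborFinset v, y u < μ * y v) : graphSpectralRadius G < μ := by
  obtain ⟨z, hz0, ⟨w, hw⟩, hz⟩ := exists_nonneg_subeigenvector G
  have h1 : ∑ v, y v * (graphSpectralRadius G * z v) ≤
      ∑ v, y v * ∑ u ∈ G.neighborFinset v, z u :=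
    Finset.sum_le_sum fun v _ => mul_le_mul_of_nonneg_left (hz v) (hy v).le
  rw [sum_mul_sum_neighborFinset_comm] at h1
  have h2 : ∑ v, z v * ∑ u ∈ G.neighborFinset v, y u < ∑ v, z v * (μ * y v) :=
    Finset.sum_lt_sum (fun v _ => mul_le_mul_of_nonneg_left (h v).le (hz0 v))
      ⟨w, Finset.mem_univ _, mul_lt_mul_of_pos_left (h w) hw⟩
  have h3 : 0 < ∑ v, z v * y v := Finset.sum_pos' (fun v _ => mul_nonneg (hz0 v) (hy v).le)
    ⟨w, Finset.mem_univ _, mul_pos hw (hy w)⟩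
  have e1 : ∑ v, y v * (graphSpectralRadius G * z v) =
      graphSpectralRadius G * ∑ v, z v * y v := by
    rw [Finset.mul_sum]; exact Finset.sum_congr rfl fun _ _ => by ring
  have e2 : ∑ v, z v * (μ * y v) = μ * ∑ v, z v * y v := by
    rw [Finset.mul_sum]; exact Finset.sum_congr rfl fun _ _ => by ring
  rw [e1] at h1
  rw [e2] at h2
  exact lt_of_mul_lt_mul_right (h1.trans_lt h2) h3.le

/-- The Hong–Shu–Fang–Nikiforov bound, with the square root cleared:
`r² - (k - 1) r ≤ 2 e(G) - k (n - 1)` if the minimum degree is at least `k`. The right-hand side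
bounds every column sum of `A² - (k - 1) A`. -/
theorem sq_graphSpectralRadius_sub_le {V : Type*} [Fintype V] [DecidableEq V] [Nonempty V]
    (G : SimpleGraph V) [DecidableRel G.Adj] (k : ℕ) (hk : ∀ v, k ≤ G.degree v)
    (hr : 0 ≤ graphSpectralRadius G) :
    graphSpectralRadius G ^ 2 - (k - 1) * graphSpectralRadius G ≤
      ∑ v, (G.degree v : ℝ) - k * (Fintype.card V - 1) := by
  obtain ⟨z, hz0, ⟨w, hw⟩, hz⟩ := exists_nonneg_subeigenvector G
  set r := graphSpectralRadius G
  set B : V → ℝ := fun v => ∑ u ∈ G.neighborFinset v, z u with hB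
  have hk' : ∀ v, (k : ℝ) ≤ G.degree v := fun v => by exact_mod_cast hk v
  have hzpos : 0 < ∑ v, z v := Finset.sum_pos' (fun v _ => hz0 v) ⟨w, Finset.mem_univ _, hw⟩
  have hBsum : ∑ v, B v = ∑ v, z v * G.degree v := by
    have := sum_mul_sum_neighborFinset_comm G (fun _ => 1) z
    simpa [hB] using this
  have hBdeg : ∑ v, (G.degree v : ℝ) * B v =
      ∑ v, z v * ∑ u ∈ G.neighborFinset v, (G.degree u : ℝ) :=
    sum_mul_sum_neighborFinset_comm G (fun v => (G.degree v : ℝ)) z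
  have hBz : r * ∑ v, z v ≤ ∑ v, B v := by
    rw [Finset.mul_sum]; exact Finset.sum_le_sum fun v _ => hz v
  have hlow : ∑ v, (r * z v) * (G.degree v - (k - 1)) ≤ ∑ v, B v * (G.degree v - (k - 1)) :=
    Finset.sum_le_sum fun v _ => mul_le_mul_of_nonneg_right (hz v) (by linarith [hk' v])
  have e1 : ∑ v, (r * z v) * (G.degree v - (k - 1)) = r * (∑ v, B v - (k - 1) * ∑ v, z v) := by
    rw [hBsum, Finset.mul_sum, ← Finset.sum_sub_distrib, Finset.mul_sum]
    exact Finset.sum_congr rfl fun _ _ => by ring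
  have e2 : ∑ v, B v * (G.degree v - (k - 1)) =
      ∑ v, z v * (∑ u ∈ G.neighborFinset v, (G.degree u : ℝ) - (k - 1) * G.degree v) := by
    have : ∑ v, B v * (G.degree v - (k - 1)) =
        ∑ v, (G.degree v : ℝ) * B v - (k - 1) * ∑ v, B v := by
      rw [Finset.mul_sum, ← Finset.sum_sub_distrib]
      exact Finset.sum_congr rfl fun _ _ => by ring
    rw [this, hBdeg, hBsum, Finset.mul_sum, ← Finset.sum_sub_distrib]
    exact Finset.sum_congr rfl fun _ _ => by ring
  have hcol : ∀ v, ∑ u ∈ G.neighborFinset v, (G.degree u : ℝ) - (k - 1) * G.degree v ≤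
      ∑ v, (G.degree v : ℝ) - k * (Fintype.card V - 1) := by
    intro v
    have hv : v ∉ G.neighborFinset v := by simp
    set S := insert v (G.neighborFinset v) with hS
    have hSc : S.card = G.degree v + 1 := by
      rw [hS, Finset.card_insert_of_notMem hv, SimpleGraph.card_neighborFinset_eq_degree]
    have h1 : ∑ u ∈ S, (G.degree u : ℝ) + ∑ u ∈ Sᶜ, (G.degree u : ℝ) = ∑ u, (G.degree u : ℝ) :=
      Finset.sum_add_sum_compl _ _
    rw [hS, Finset.sum_insert hv, ← hS] at h1
    have h2 : (Sᶜ.card : ℝ) * k ≤ ∑ u ∈ Sᶜ, (G.degree u : ℝ) := by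
      rw [← nsmul_eq_mul]; exact Finset.card_nsmul_le_sum _ _ _ fun u _ => hk' u
    have h3 : (Sᶜ.card : ℝ) = Fintype.card V - (G.degree v + 1) := by
      rw [Finset.card_compl, Nat.cast_sub (Finset.card_le_univ _), hSc]; push_cast; ring
    rw [h3] at h2
    linarith
  have hup : ∑ v, z v * (∑ u ∈ G.neighborFinset v, (G.degree u : ℝ) - (k - 1) * G.degree v) ≤
      (∑ v, (G.degree v : ℝ) - k * (Fintype.card V - 1)) * ∑ v, z v := by
    rw [Finset.mul_sum]
    refine Finset.sum_le_sum fun v _ => ?_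
    rw [mul_comm]
    exact mul_le_mul_of_nonneg_right (hcol v) (hz0 v)
  have hfin : (r ^ 2 - (k - 1) * r) * ∑ v, z v ≤
      (∑ v, (G.degree v : ℝ) - k * (Fintype.card V - 1)) * ∑ v, z v := by
    have := mul_le_mul_of_nonneg_left hBz hr
    rw [e1, e2] at hlow
    linarith [this, hup, hlow]
  exact le_of_mul_le_mul_right hfin hzpos

/-- The lower bound for `2 e(G)` that the spectral hypothesis gives. It falls short of the
value `(n - k) (n - k - 1) + 2 k²` for `graphN n k` by only `k²`. -/
theorem le_sum_degree_of_le_graphSpectralRadius {V : Type*} [Fintype V] [DecidableEq V]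
    (G : SimpleGraph V) [DecidableRel G.Adj] (n k : ℕ) (hcard : Fintype.card V = n)
    (hnk : 6 * k + 5 ≤ n) (hk : ∀ v, k ≤ G.degree v)
    (hspec : (n : ℝ) - (k : ℝ) - 1 ≤ graphSpectralRadius G) :
    (n : ℤ) ^ 2 - (2 * k + 1) * n + 2 * k ^ 2 + k ≤ ∑ v, (G.degree v : ℤ) := by
  have hne : Nonempty V := Fintype.card_pos_iff.1 (by omega)
  have hnk' : 6 * (k : ℝ) + 5 ≤ n := by exact_mod_cast hnk
  have hk0 : (0 : ℝ) ≤ k := k.cast_nonneg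
  have h := sq_graphSpectralRadius_sub_le G k hk (by linarith)
  rw [hcard] at h
  set r := graphSpectralRadius G
  have h2 : 0 ≤ (r - (n - k - 1)) * (r + (n - k - 1) - (k - 1)) :=
    mul_nonneg (by linarith) (by linarith)
  have h3 : (n : ℝ) ^ 2 - (2 * k + 1) * n + 2 * k ^ 2 + k ≤ ∑ v, (G.degree v : ℝ) := by
    nlinarith
  exact_mod_cast h3

/-! ### Structure of dense graphs closed under Ore's condition -/

theorem sum_card_neighborFinset_inter {V : Type*} [Fintype V] [DecidableEq V]
    (G : SimpleGraph V) [DecidableRel G.Adj] (A : Finset V) :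
    ∑ w, (G.neighborFinset w ∩ A).card = ∑ a ∈ A, G.degree a := by
  have h1 : ∀ w, (G.neighborFinset w ∩ A).card = ∑ a ∈ A, if G.Adj w a then 1 else 0 := by
    intro w
    rw [Finset.inter_comm, ← Finset.filter_mem_eq_inter, Finset.card_filter]
    simp
  simp_rw [h1]
  rw [Finset.sum_comm]
  refine Finset.sum_congr rfl fun a _ => ?_
  rw [← SimpleGraph.card_neighborFinset_eq_degree, SimpleGraph.neighborFinset_eq_filter,
    Finset.card_filter]
  simp only [G.adj_comm a]

/-- With `i` the smaller degree of a maximal non-adjacent pair, the total degree is at most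
`n (n - 1) - 2 i n + 3 i² + i`. This quantity is convex in `i`, so on `k + 1 ≤ i ≤ (n - 1) / 2` it
is largest at an endpoint, and there it is too small. -/
theorem sum_bound_lt_of_lt {n k i : ℤ} (hk : 1 ≤ k) (h1 : 6 * k + 5 ≤ n)
    (h2 : k ^ 3 + 2 * k + 5 ≤ 2 * n) (hki : k < i) (hin : 2 * i ≤ n - 1) :
    n * (n - 1) - 2 * i * n + 3 * i ^ 2 + i < n ^ 2 - (2 * k + 1) * n + 2 * k ^ 2 + k := by
  have q1 : k ^ 2 + 6 * k + 4 < 2 * n := by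
    rcases le_or_gt k 3 with h | h
    · interval_cases k <;> omega
    · nlinarith [mul_nonneg (show 0 ≤ k by omega) (mul_nonneg (show 0 ≤ k - 4 by omega)
        (show 0 ≤ k + 3 by omega))]
  have qJ : 4 * k ^ 2 < (n - 1 - 2 * k) * (n - 6 * k + 1) := by
    rcases le_or_gt k 6 with h | h
    · nlinarith
    · have : 49 * k ≤ k ^ 3 := by
        nlinarith [mul_nonneg (show 0 ≤ k by omega)
          (mul_nonneg (show 0 ≤ k - 7 by omega) (show 0 ≤ k + 7 by omega))]
      have h3 : 22 * k ≤ n - 1 - 2 * k := by omega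
      have h4 : 18 * k ≤ n - 6 * k + 1 := by omega
      nlinarith [mul_le_mul h3 h4 (by omega) (by omega)]
  obtain ⟨j, rfl⟩ : ∃ j, i = k + j := ⟨i - k, by ring⟩
  have hj1 : 0 ≤ j - 1 := by omega
  have hjJ : 0 ≤ n - 1 - 2 * k - 2 * j := by omega
  -- linear interpolation between `j = 1` and `2 j = n - 1 - 2 k`
  have hJ : 0 < n - 1 - 2 * k - 2 := by omega
  have key : 0 < (n - 1 - 2 * k - 2) * (j * (2 * n - 6 * k - 1 - 3 * j) - k ^ 2) := by
    have e : 2 * ((n - 1 - 2 * k - 2) * (j * (2 * n - 6 * k - 1 - 3 * j) - k ^ 2)) =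
        3 * (n - 1 - 2 * k - 2) * ((j - 1) * (n - 1 - 2 * k - 2 * j)) +
        2 * (n - 1 - 2 * k - 2 * j) * (2 * n - 6 * k - 4 - k ^ 2) +
        (j - 1) * ((n - 1 - 2 * k) * (n - 6 * k + 1) - 4 * k ^ 2) := by ring
    have t1 := mul_nonneg (mul_nonneg (show (0 : ℤ) ≤ 3 by norm_num) hJ.le) (mul_nonneg hj1 hjJ)
    have t2 : 0 ≤ 2 * (n - 1 - 2 * k - 2 * j) * (2 * n - 6 * k - 4 - k ^ 2) :=
      mul_nonneg (by omega) (by linarith)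
    have t3 : 0 ≤ (j - 1) * ((n - 1 - 2 * k) * (n - 6 * k + 1) - 4 * k ^ 2) :=
      mul_nonneg hj1 (by linarith)
    rcases hjJ.lt_or_eq with h | h
    · have : 0 < 2 * (n - 1 - 2 * k - 2 * j) * (2 * n - 6 * k - 4 - k ^ 2) :=
        mul_pos (by omega) (by linarith)
      linarith
    · have : 0 < (j - 1) * ((n - 1 - 2 * k) * (n - 6 * k + 1) - 4 * k ^ 2) :=
        mul_pos (by omega) (by linarith)
      linarith
  have := (mul_pos_iff_of_pos_left hJ).1 key
  nlinarith

/-- In a graph closed under Ore's condition, with minimum degree at least `k` and almost as many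
edges as a non-Hamiltonian graph can have, all vertices outside a set of `k` vertices of degree `k`
form a clique. The set consists of the non-neighbours of `v`, where `u`, `v` is a non-adjacent pair
with the largest degree sum and `v` has the larger degree. -/
theorem exists_compl_clique {V : Type*} [Fintype V] [DecidableEq V]
    (H : SimpleGraph V) [DecidableRel H.Adj] (n k : ℕ) (hcard : Fintype.card V = n)
    (hk : 1 ≤ k) (h1 : 6 * k + 5 ≤ n) (h2 : k ^ 3 + 2 * k + 5 ≤ 2 * n)
    (hdeg : ∀ v, k ≤ H.degree v)
    (hore : ∀ u v, u ≠ v → ¬ H.Adj u v → H.degree u + H.degree v < n)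
    (hnc : ∃ u v, u ≠ v ∧ ¬ H.Adj u v)
    (hsum : (n : ℤ) ^ 2 - (2 * k + 1) * n + 2 * k ^ 2 + k ≤ ∑ v, (H.degree v : ℤ)) :
    ∃ A : Finset V, A.card = k ∧ (∀ a ∈ A, H.degree a = k) ∧
      ∀ x, x ∉ A → ∀ y, y ∉ A → x ≠ y → H.Adj x y := by
  have hkZ : (1 : ℤ) ≤ k := by exact_mod_cast hk
  have h1Z : 6 * (k : ℤ) + 5 ≤ n := by exact_mod_cast h1
  have h2Z : (k : ℤ) ^ 3 + 2 * k + 5 ≤ 2 * n := by exact_mod_cast h2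
  have hsq : (k : ℤ) ^ 2 + 2 * k + 1 < n := by
    rcases le_or_gt (k : ℤ) 3 with h | h
    · nlinarith
    · nlinarith [mul_nonneg (show 0 ≤ (k : ℤ) by omega) (mul_nonneg (show 0 ≤ (k : ℤ) - 4 by omega)
        (show 0 ≤ (k : ℤ) + 2 by omega))]
  obtain ⟨u, v, huv, hadj, hle, hmax⟩ : ∃ u v, u ≠ v ∧ ¬ H.Adj u v ∧ H.degree u ≤ H.degree v ∧
      ∀ x y, x ≠ y → ¬ H.Adj x y → H.degree x + H.degree y ≤ H.degree u + H.degree v := by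
    obtain ⟨u₀, v₀, h0, h0'⟩ := hnc
    obtain ⟨⟨u, v⟩, hmem, hmax⟩ := Finset.exists_max_image
      (Finset.univ.filter fun e : V × V => e.1 ≠ e.2 ∧ ¬ H.Adj e.1 e.2)
      (fun e => H.degree e.1 + H.degree e.2) ⟨(u₀, v₀), by simp [h0, h0']⟩
    simp only [Finset.mem_filter, Finset.mem_univ, true_and] at hmem hmax
    have hmax' : ∀ x y, x ≠ y → ¬ H.Adj x y →
        H.degree x + H.degree y ≤ H.degree u + H.degree v := fun x y hx hy => hmax (x, y) ⟨hx, hy⟩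
    rcases le_total (H.degree u) (H.degree v) with h | h
    · exact ⟨u, v, hmem.1, hmem.2, h, hmax'⟩
    · exact ⟨v, u, hmem.1.symm, fun h' => hmem.2 h'.symm, h, fun x y hx hy => by
        rw [add_comm (H.degree v)]; exact hmax' x y hx hy⟩
  have huvn := hore u v huv hadj
  set A := (insert v (H.neighborFinset v))ᶜ with hA
  set B := (H.neighborFinset u)ᶜ with hB
  have hmemA : ∀ w, w ∈ A ↔ w ≠ v ∧ ¬ H.Adj v w := by intro w; simp [hA]
  have hAcard : A.card + H.degree v + 1 = n := by
    have h := Finset.card_compl_add_card (insert v (H.neighborFinset v))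
    rw [Finset.card_insert_of_notMem (by simp), SimpleGraph.card_neighborFinset_eq_degree,
      hcard, ← hA] at h
    omega
  have hBcard : B.card + H.degree u = n := by
    have h := Finset.card_compl_add_card (H.neighborFinset u)
    rwa [SimpleGraph.card_neighborFinset_eq_degree, hcard] at h
  have hAdeg : ∀ w ∈ A, H.degree w ≤ H.degree u := by
    intro w hw
    obtain ⟨hw1, hw2⟩ := (hmemA w).1 hw
    have := hmax w v hw1 (fun h => hw2 h.symm)
    omega
  have hBdeg : ∀ w ∈ B, H.degree w ≤ H.degree v := by
    intro w hw
    by_cases hwu : w = u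
    · rw [hwu]; exact hle
    · have := hmax u w (Ne.symm hwu) (by simpa [hB] using hw)
      omega
  set i := H.degree u with hi
  have hpt : ∀ w, (H.degree w : ℤ) ≤ (n - 1) - (if w ∈ B then (i : ℤ) else 0) -
      (if w ∈ A then ((n : ℤ) - 1 - 2 * i) else 0) := by
    intro w
    have hw := H.degree_lt_card_verts w
    rw [hcard] at hw
    have hA' := hAdeg w
    have hB' := hBdeg w
    by_cases hwA : w ∈ A <;> by_cases hwB : w ∈ B <;> simp only [hwA, hwB, if_true, if_false]
    · have := hA' hwA; omega
    · have := hA' hwA; omega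
    · have := hB' hwB; omega
    · omega
  have htot : ∑ w, (H.degree w : ℤ) ≤ n * (n - 1) - (n - i) * i - A.card * (n - 1 - 2 * i) := by
    refine (Finset.sum_le_sum fun w _ => hpt w).trans (le_of_eq ?_)
    rw [Finset.sum_sub_distrib, Finset.sum_sub_distrib, Finset.sum_ite_mem, Finset.sum_ite_mem]
    simp only [Finset.univ_inter, Finset.sum_const, Finset.card_univ, hcard, nsmul_eq_mul]
    have : (B.card : ℤ) = n - i := by omega
    rw [this]
  have hAi : i ≤ A.card := by omega
  have hki : k ≤ i := hdeg u
  have hin : 2 * (i : ℤ) ≤ n - 1 := by omega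
  have hik : i = k := by
    by_contra hne
    have hlt : (k : ℤ) < i := by omega
    have := sum_bound_lt_of_lt hkZ h1Z h2Z hlt hin
    have h3 : (i : ℤ) * (n - 1 - 2 * i) ≤ A.card * (n - 1 - 2 * i) :=
      mul_le_mul_of_nonneg_right (by exact_mod_cast hAi) (by omega)
    nlinarith
  rw [hik] at htot hAi hAdeg huvn
  have hAk : A.card = k := by
    by_contra hne
    have hlt : (k : ℤ) + 1 ≤ A.card := by omega
    have h3 : ((k : ℤ) + 1) * (n - 1 - 2 * k) ≤ A.card * (n - 1 - 2 * k) :=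
      mul_le_mul_of_nonneg_right hlt (by omega)
    nlinarith
  have hAdeg' : ∀ a ∈ A, H.degree a = k := fun a ha => le_antisymm (hAdeg a ha) (hdeg a)
  refine ⟨A, hAk, hAdeg', fun x hx y hy hxy => ?_⟩
  by_contra hxyadj
  have hxyd := hore x y hxy hxyadj
  have hAsum : ∑ w ∈ A, (H.degree w : ℤ) = k * k := by
    rw [Finset.sum_congr rfl fun a ha => by rw [hAdeg' a ha]]
    simp [hAk]
  have hinter : ∑ w, ((H.neighborFinset w ∩ A).card : ℤ) = k * k := by
    rw [← hAsum]
    exact_mod_cast sum_card_neighborFinset_inter H A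
  have hCdeg : ∀ w ∈ Aᶜ, (H.degree w : ℤ) ≤ (n - k - 1) + (H.neighborFinset w ∩ A).card := by
    intro w hw
    have e1 : (H.neighborFinset w ∩ A).card + (H.neighborFinset w \ A).card = H.degree w := by
      rw [Finset.card_inter_add_card_sdiff, SimpleGraph.card_neighborFinset_eq_degree]
    have e2 : (H.neighborFinset w \ A).card ≤ (Aᶜ.erase w).card := by
      refine Finset.card_le_card fun t ht => ?_
      rw [Finset.mem_sdiff, SimpleGraph.mem_neighborFinset] at ht
      exact Finset.mem_erase.2 ⟨ht.1.ne', Finset.mem_compl.2 ht.2⟩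
    rw [Finset.card_erase_of_mem hw, Finset.card_compl, hcard, hAk] at e2
    omega
  have hxC : x ∈ Aᶜ := Finset.mem_compl.2 hx
  have hyC : y ∈ Aᶜ.erase x := Finset.mem_erase.2 ⟨hxy.symm, Finset.mem_compl.2 hy⟩
  have s1 : ∑ w ∈ A, (H.degree w : ℤ) + ∑ w ∈ Aᶜ, (H.degree w : ℤ) = ∑ w, (H.degree w : ℤ) :=
    Finset.sum_add_sum_compl _ _
  rw [← Finset.add_sum_erase _ _ hxC, ← Finset.add_sum_erase _ _ hyC, hAsum] at s1
  have s2 : ∑ w ∈ (Aᶜ.erase x).erase y, (H.degree w : ℤ) ≤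
      (n - k - 2) * (n - k - 1) + k * k := by
    calc ∑ w ∈ (Aᶜ.erase x).erase y, (H.degree w : ℤ)
        ≤ ∑ w ∈ (Aᶜ.erase x).erase y, (((n : ℤ) - k - 1) + (H.neighborFinset w ∩ A).card) :=
          Finset.sum_le_sum fun w hw =>
            hCdeg w (Finset.mem_of_mem_erase (Finset.mem_of_mem_erase hw))
      _ = (n - k - 2) * (n - k - 1) +
          ∑ w ∈ (Aᶜ.erase x).erase y, ((H.neighborFinset w ∩ A).card : ℤ) := by
          rw [Finset.sum_add_distrib, Finset.sum_const, Finset.card_erase_of_mem hyC,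
            Finset.card_erase_of_mem hxC, Finset.card_compl, hcard, hAk, nsmul_eq_mul]
          have : ((n - k - 1 - 1 : ℕ) : ℤ) = n - k - 2 := by omega
          rw [this]
      _ ≤ _ := by
          rw [← hinter]
          have := Finset.sum_le_sum_of_subset_of_nonneg
            (Finset.subset_univ ((Aᶜ.erase x).erase y))
            (f := fun w => ((H.neighborFinset w ∩ A).card : ℤ)) (fun _ _ _ => by positivity)
          linarith
  have hxyd' : (H.degree x : ℤ) + H.degree y ≤ n - 1 := by omega
  nlinarith

/-! ### Spectral radius when a clique edge is missing -/

/-- The weights used in `graphSpectralRadius_lt_of_not_adj`. To first order in `1 / μ` they are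
`α ≈ k / μ`, `β ≈ k² / μ²` and `γ ≈ 1 / μ`, so `k β < 2 γ` amounts to `k³ < 2 μ`. -/
theorem exists_certificate_weights {k μ : ℝ} (hk : 1 ≤ k) (hμ : 9 ≤ μ) (hkμ : k < μ)
    (h3 : k ^ 3 ≤ 2 * μ - 3) (h2 : 2 * k ^ 2 < μ + 6) :
    ∃ α β γ : ℝ, 0 < α ∧ 0 < β ∧ 0 < γ ∧ (μ + 2) * γ = 1 ∧ k * β < 2 * γ ∧
      k * α ≤ (μ + 1) * β ∧ k * (1 + β) < μ * α ∧ α ≤ 1 + β := by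
  have hk0 : 0 < k := by linarith
  have hden : 0 < μ * (μ + 1) - k ^ 2 := by nlinarith
  have hlt : k ^ 2 / (μ * (μ + 1) - k ^ 2) < 2 / (k * (μ + 2)) := by
    rw [div_lt_div_iff₀ hden (by positivity)]
    nlinarith
  obtain ⟨β, hβ1, hβ2⟩ := exists_between hlt
  rw [div_lt_iff₀ hden] at hβ1
  rw [lt_div_iff₀ (by positivity)] at hβ2
  have hβ : 0 < β := by
    by_contra! h
    nlinarith [sq_nonneg k]
  have hγ : (μ + 2) * (1 / (μ + 2)) = 1 := by field_simp
  refine ⟨min (1 + β) ((μ + 1) * β / k), β, 1 / (μ + 2), ?_, hβ, by positivity, hγ, ?_, ?_, ?_,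
    min_le_left _ _⟩
  · exact lt_min (by linarith) (by positivity)
  · rw [mul_one_div, lt_div_iff₀ (by linarith)]; linarith
  · calc k * min (1 + β) ((μ + 1) * β / k) ≤ k * ((μ + 1) * β / k) :=
        mul_le_mul_of_nonneg_left (min_le_right _ _) hk0.le
      _ = _ := by field_simp
  · rw [mul_min_of_nonneg _ _ (by linarith)]
    refine lt_min (mul_lt_mul_of_pos_right hkμ (by linarith)) ?_
    rw [← mul_div_assoc, lt_div_iff₀ hk0]
    nlinarith

/-- If an edge `pq` is missing inside the complement of `A`, then the spectral radius is below
`n - k - 1`. Here `A` has `k` vertices of degree at most `k`, and `X` contains the neighbours of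
`A` outside `A`. The Collatz–Wielandt bound is applied to the weights `α` on `A`, `1 + β` on
`X` and `1` elsewhere, lowered by `γ` at `p` and `q`. -/
theorem graphSpectralRadius_lt_of_not_adj {V : Type*} [Fintype V] [DecidableEq V]
    (G : SimpleGraph V) [DecidableRel G.Adj] (n k : ℕ) (hcard : Fintype.card V = n)
    (hk : 1 ≤ k) (h1 : 6 * k + 5 ≤ n) (h2 : k ^ 3 + 2 * k + 5 ≤ 2 * n)
    (A X : Finset V) (hA : A.card = k) (hX : X.card ≤ k) (hAdeg : ∀ a ∈ A, G.degree a ≤ k)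
    (hAX : ∀ c, c ∉ A → c ∉ X → ∀ a ∈ A, ¬ G.Adj c a)
    {p q : V} (hp : p ∉ A) (hq : q ∉ A) (hpq : p ≠ q) (hadj : ¬ G.Adj p q) :
    graphSpectralRadius G < n - k - 1 := by
  have hne : Nonempty V := ⟨p⟩
  have hkR : (1 : ℝ) ≤ k := by exact_mod_cast hk
  have h1R : 6 * (k : ℝ) + 5 ≤ n := by exact_mod_cast h1
  have h2R : (k : ℝ) ^ 3 + 2 * k + 5 ≤ 2 * n := by exact_mod_cast h2
  set μ : ℝ := n - k - 1 with hμdef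
  have hksq : 2 * (k : ℝ) ^ 2 < μ + 6 := by
    rcases le_or_gt k 3 with h | h
    · have : (k : ℝ) ≤ 3 := by exact_mod_cast h
      nlinarith
    · have : (4 : ℝ) ≤ k := by exact_mod_cast h
      nlinarith [mul_nonneg (sq_nonneg (k : ℝ)) (show (0 : ℝ) ≤ k - 4 by linarith)]
  obtain ⟨α, β, γ, hα, hβ, hγ, hγ1, hβγ, hαβ, hαk, hα1⟩ := exists_certificate_weights hkR
    (μ := μ) (by linarith) (by linarith) (by linarith) hksq
  have hγlt : γ < 1 := by nlinarith
  set y : V → ℝ := fun v => if v ∈ A then α else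
    1 + (if v ∈ X then β else 0) - (if v = p ∨ v = q then γ else 0) with hy
  have hypos : ∀ v, 0 < y v := by
    intro v; simp only [hy]; split_ifs <;> linarith
  have hyle : ∀ v, y v ≤ 1 + β := by
    intro v; simp only [hy]; split_ifs <;> linarith
  -- the total weight outside `A`
  have hS : ∑ v ∈ Aᶜ, y v ≤ (μ + 1) + k * β - 2 * γ := by
    have e : ∀ v ∈ Aᶜ, y v = 1 + (if v ∈ X then β else 0) -
        ((if v = p then γ else 0) + if v = q then γ else 0) := by
      intro v hv
      rw [Finset.mem_compl] at hv
      simp only [hy, hv, if_false]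
      by_cases hvp : v = p
      · simp [hvp, hpq]
      · simp [hvp]
    rw [Finset.sum_congr rfl e, Finset.sum_sub_distrib, Finset.sum_add_distrib,
      Finset.sum_add_distrib, Finset.sum_ite_eq', Finset.sum_ite_eq', Finset.sum_ite_mem,
      if_pos (Finset.mem_compl.2 hp), if_pos (Finset.mem_compl.2 hq)]
    simp only [Finset.sum_const, nsmul_eq_mul, mul_one]
    have c1 : (Aᶜ.card : ℝ) = μ + 1 := by
      rw [Finset.card_compl, hcard, hA, Nat.cast_sub (by omega)]; ring
    have c2 : ((Aᶜ ∩ X).card : ℝ) ≤ k := by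
      exact_mod_cast (Finset.card_le_card Finset.inter_subset_right).trans hX
    rw [c1]
    have := mul_le_mul_of_nonneg_right c2 hβ.le
    linarith
  refine graphSpectralRadius_lt_of_sum_lt G y μ hypos fun v => ?_
  by_cases hvA : v ∈ A
  · have hyv : y v = α := by simp [hy, hvA]
    rw [hyv]
    calc ∑ u ∈ G.neighborFinset v, y u ≤ (G.neighborFinset v).card • (1 + β) :=
          Finset.sum_le_card_nsmul _ _ _ fun u _ => hyle u
      _ ≤ k * (1 + β) := by
          rw [nsmul_eq_mul, SimpleGraph.card_neighborFinset_eq_degree]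
          exact mul_le_mul_of_nonneg_right (by exact_mod_cast hAdeg v hvA) (by linarith)
      _ < μ * α := hαk
  have hsplit : ∑ u ∈ G.neighborFinset v, y u =
      ∑ u ∈ G.neighborFinset v ∩ A, y u + ∑ u ∈ G.neighborFinset v \ A, y u :=
    (Finset.sum_inter_add_sum_sdiff _ _ _).symm
  have hinA : ∑ u ∈ G.neighborFinset v ∩ A, y u ≤ if v ∈ X then k * α else 0 := by
    split_ifs with hvX
    · calc ∑ u ∈ G.neighborFinset v ∩ A, y u ≤ (G.neighborFinset v ∩ A).card • α :=
            Finset.sum_le_card_nsmul _ _ _ fun u hu => by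
              simp [hy, (Finset.mem_inter.1 hu).2]
        _ ≤ k * α := by
            rw [nsmul_eq_mul]
            refine mul_le_mul_of_nonneg_right ?_ hα.le
            exact_mod_cast hA ▸ Finset.card_le_card Finset.inter_subset_right
    · rw [Finset.sum_eq_zero]
      intro u hu
      rw [Finset.mem_inter, SimpleGraph.mem_neighborFinset] at hu
      exact absurd hu.1 (hAX v hvA hvX u hu.2)
  have hvC : v ∈ Aᶜ := Finset.mem_compl.2 hvA
  have hout : ∑ u ∈ G.neighborFinset v \ A, y u ≤ ∑ u ∈ Aᶜ, y u - y v := by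
    rw [← Finset.sum_erase_eq_sub hvC]
    refine Finset.sum_le_sum_of_subset_of_nonneg (fun t ht => ?_) fun u _ _ => (hypos u).le
    rw [Finset.mem_sdiff, SimpleGraph.mem_neighborFinset] at ht
    exact Finset.mem_erase.2 ⟨ht.1.ne', Finset.mem_compl.2 ht.2⟩
  have hout' : ∀ w, w ∉ A → v ≠ w → ¬ G.Adj v w →
      ∑ u ∈ G.neighborFinset v \ A, y u ≤ ∑ u ∈ Aᶜ, y u - y v - y w := by
    intro w hw hvw hvwadj
    have hwC : w ∈ Aᶜ.erase v := Finset.mem_erase.2 ⟨hvw.symm, Finset.mem_compl.2 hw⟩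
    rw [← Finset.sum_erase_eq_sub hvC, ← Finset.sum_erase_eq_sub hwC]
    refine Finset.sum_le_sum_of_subset_of_nonneg (fun t ht => ?_) fun u _ _ => (hypos u).le
    rw [Finset.mem_sdiff, SimpleGraph.mem_neighborFinset] at ht
    refine Finset.mem_erase.2 ⟨?_, Finset.mem_erase.2 ⟨ht.1.ne', Finset.mem_compl.2 ht.2⟩⟩
    rintro rfl
    exact hvwadj ht.1
  have hyp : 1 - γ ≤ y p := by simp only [hy, hp, if_false]; split_ifs <;> simp_all; linarith
  have hyq : 1 - γ ≤ y q := by simp only [hy, hq, if_false]; split_ifs <;> simp_all; linarith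
  rw [hsplit]
  by_cases hvpq : v = p ∨ v = q
  · have hout2 : ∑ u ∈ G.neighborFinset v \ A, y u ≤ ∑ u ∈ Aᶜ, y u - y v - (1 - γ) := by
      rcases hvpq with rfl | rfl
      · linarith [hout' q hq hpq hadj]
      · linarith [hout' p hp hpq.symm fun h => hadj h.symm]
    by_cases hvX : v ∈ X
    · have hyv : y v = 1 + β - γ := by simp [hy, hvA, hvX, hvpq]
      rw [if_pos hvX] at hinA
      rw [hyv] at hout2 ⊢
      linarith
    · have hyv : y v = 1 - γ := by simp [hy, hvA, hvX, hvpq]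
      rw [if_neg hvX] at hinA
      rw [hyv] at hout2 ⊢
      linarith
  · by_cases hvX : v ∈ X
    · have hyv : y v = 1 + β := by simp [hy, hvA, hvX, hvpq]
      rw [if_pos hvX] at hinA
      rw [hyv] at hout ⊢
      linarith
    · have hyv : y v = 1 := by simp [hy, hvA, hvX, hvpq]
      rw [if_neg hvX] at hinA
      rw [hyv] at hout ⊢
      linarith

/-! ### The attachment of the low-degree vertices to the clique -/

theorem card_neighborFinset_inter_eq_degree_comap {V : Type*} [Fintype V] [DecidableEq V]
    (G : SimpleGraph V) [DecidableRel G.Adj] (W : Finset V) (v : {v // v ∈ W}) :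
    (G.neighborFinset v ∩ W).card =
      (G.comap (Subtype.val : {v // v ∈ W} → V)).degree v := by
  rw [← SimpleGraph.card_neighborFinset_eq_degree,
    ← Finset.card_image_of_injective _ Subtype.val_injective]
  congr 1
  ext w
  simp only [Finset.mem_inter, SimpleGraph.mem_neighborFinset, Finset.mem_image,
    SimpleGraph.comap_adj, Subtype.exists, exists_and_left, exists_prop]
  constructor
  · rintro ⟨h1, h2⟩; exact ⟨w, h1, h2, rfl⟩
  · rintro ⟨w', h1, h2, rfl⟩; exact ⟨h1, h2⟩

/-- Let `A` consist of `k` vertices of degree `k` whose outside neighbours are exactly the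
vertices of `X`, and let the complement of `A` be a clique. If `2 ≤ |X| < k` then the graph is
Hamiltonian: for `x ∈ X`, Dirac's theorem gives a Hamiltonian cycle on `A ∪ (X \ {x})`, which is
cut open after some vertex of `X` and closed up through the remaining vertices and `x`. -/
theorem isHamiltonian_of_two_le_card_lt {V : Type*} [Fintype V] [DecidableEq V]
    (G : SimpleGraph V) [DecidableRel G.Adj] (n k : ℕ) (hcard : Fintype.card V = n)
    (h1 : 6 * k + 5 ≤ n) (A X : Finset V) (hA : A.card = k) (hAdeg : ∀ a ∈ A, G.degree a = k)
    (hC : ∀ x, x ∉ A → ∀ y, y ∉ A → x ≠ y → G.Adj x y) (hXA : ∀ x ∈ X, x ∉ A)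
    (hAX : ∀ c, c ∉ A → ∀ a ∈ A, (G.Adj c a ↔ c ∈ X)) (hX2 : 2 ≤ X.card) (hXk : X.card < k) :
    G.IsHamiltonian := by
  obtain ⟨x, hx⟩ : X.Nonempty := Finset.card_pos.1 (by omega)
  obtain ⟨y, hy⟩ : (X.erase x).Nonempty :=
    Finset.card_pos.1 (by rw [Finset.card_erase_of_mem hx]; omega)
  have hyX : y ∈ X := Finset.mem_of_mem_erase hy
  have hdom : ∀ z ∈ X, ∀ w, z ≠ w → G.Adj z w := by
    intro z hz w hzw
    by_cases hw : w ∈ A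
    · exact (hAX z (hXA z hz) w hw).2 hz
    · exact hC z (hXA z hz) w hw hzw
  set W := A ∪ X.erase x with hW
  have hdisj : Disjoint A (X.erase x) := Finset.disjoint_left.2 fun a ha ha' =>
    hXA a (Finset.mem_of_mem_erase ha') ha
  have hWcard : W.card + 1 = k + X.card := by
    rw [hW, Finset.card_union_of_disjoint hdisj, hA, Finset.card_erase_of_mem hx]; omega
  have hxW : x ∉ W := by simp [hW, hXA x hx]
  have hQ : (G.comap (Subtype.val : {v // v ∈ W} → V)).IsHamiltonian := by
    refine isHamiltonian_of_card_le_two_mul_degree ?_ fun v => ?_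
    · rw [Fintype.card_coe]; omega
    · rw [Fintype.card_coe, ← card_neighborFinset_inter_eq_degree_comap]
      obtain ⟨v, hv⟩ := v
      show W.card ≤ 2 * (G.neighborFinset v ∩ W).card
      rcases Finset.mem_union.1 hv with hvA | hvX
      · have : (G.neighborFinset v).erase x ⊆ G.neighborFinset v ∩ W := by
          intro t ht
          obtain ⟨htx, ht⟩ := Finset.mem_erase.1 ht
          refine Finset.mem_inter.2 ⟨ht, ?_⟩
          rw [SimpleGraph.mem_neighborFinset] at ht
          by_cases htA : t ∈ A
          · exact Finset.mem_union_left _ htA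
          · exact Finset.mem_union_right _
              (Finset.mem_erase.2 ⟨htx, (hAX t htA v hvA).1 ht.symm⟩)
        have hc := Finset.card_le_card this
        have := Finset.pred_card_le_card_erase (s := G.neighborFinset v) (a := x)
        rw [SimpleGraph.card_neighborFinset_eq_degree, hAdeg v hvA] at this
        omega
      · have : W.erase v ⊆ G.neighborFinset v ∩ W := by
          intro t ht
          obtain ⟨htv, ht⟩ := Finset.mem_erase.1 ht
          refine Finset.mem_inter.2 ⟨?_, ht⟩
          rw [SimpleGraph.mem_neighborFinset]
          exact hdom v (Finset.mem_of_mem_erase hvX) t htv.symm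
        have := Finset.card_le_card this
        rw [Finset.card_erase_of_mem hv] at this
        omega
  have hyW : y ∈ W := Finset.mem_union_right _ hy
  have hnt : Nontrivial {v // v ∈ W} := Fintype.one_lt_card_iff_nontrivial.1 (by
    rw [Fintype.card_coe]; omega)
  obtain ⟨c, hc⟩ := hQ.exists_isHamiltonianCycle ⟨y, hyW⟩
  set p := c.tail
  have hp : p.IsHamiltonian := hc.isHamiltonian_tail
  set l : List V := p.support.map Subtype.val with hl
  have hlne : l ≠ [] := fun h => p.support_ne_nil (List.map_eq_nil_iff.1 h)
  have hlmem : ∀ w, w ∈ l ↔ w ∈ W := by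
    intro w
    simp [hl, hp.mem_support]
  have hlnd : l.Nodup := hp.isPath.support_nodup.map Subtype.val_injective
  have hlch : l.IsChain G.Adj := (List.isChain_map _).2 p.isChain_adj_support
  have hllast : ∀ z ∈ l.getLast?, z = y := by
    intro z hz
    rw [hl, List.getLast?_map, List.getLast?_eq_some_getLast p.support_ne_nil,
      SimpleGraph.Walk.getLast_support] at hz
    simpa using hz.symm
  set R := (Aᶜ \ X).toList with hR
  have hRmem : ∀ w, w ∈ R ↔ w ∉ A ∧ w ∉ X := by intro w; simp [hR]
  have hRne : R ≠ [] := by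
    intro h
    have h2 : R.length = (Aᶜ \ X).card := Finset.length_toList _
    have h3 := Finset.le_card_sdiff X Aᶜ
    rw [Finset.card_compl, hcard, hA] at h3
    rw [h] at h2
    simp only [List.length_nil] at h2
    omega
  have hRnd : R.Nodup := Finset.nodup_toList _
  have hRch : (R ++ [x]).IsChain G.Adj := by
    have hnd : (R ++ [x]).Nodup := by
      rw [List.nodup_append]
      refine ⟨hRnd, by simp, fun a ha b hb => ?_⟩
      rw [List.mem_singleton] at hb
      rintro rfl
      exact ((hRmem a).1 ha).2 (hb ▸ hx)
    have hnotA : ∀ w ∈ R ++ [x], w ∉ A := by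
      intro w hw
      rcases List.mem_append.1 hw with hw | hw
      · exact ((hRmem w).1 hw).1
      · rw [List.mem_singleton.1 hw]; exact hXA x hx
    refine List.Pairwise.isChain (List.Pairwise.imp_of_mem ?_ hnd)
    intro a b ha hb hab
    exact hC a (hnotA a ha) b (hnotA b hb) hab
  refine isHamiltonian_of_list (by omega) (l ++ (R ++ [x])) (by simp) ?_ ?_ ?_ ?_
  · rw [List.nodup_append, List.nodup_append]
    refine ⟨hlnd, ⟨hRnd, by simp, fun a ha b hb => ?_⟩, fun a ha b hb => ?_⟩
    · rw [List.mem_singleton] at hb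
      rintro rfl
      exact ((hRmem a).1 ha).2 (hb ▸ hx)
    · rintro rfl
      rw [hlmem] at ha
      rcases List.mem_append.1 hb with hb | hb
      · rw [hRmem] at hb
        rcases Finset.mem_union.1 ha with ha | ha
        · exact hb.1 ha
        · exact hb.2 (Finset.mem_of_mem_erase ha)
      · rw [List.mem_singleton.1 hb] at ha; exact hxW ha
  · intro w
    simp only [List.mem_append, List.mem_singleton, hlmem, hRmem, hW, Finset.mem_union,
      Finset.mem_erase]
    tauto
  · refine List.IsChain.append hlch hRch ?_
    intro z hz t ht
    rw [hllast z hz]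
    have htR : t ∈ R := by
      rw [List.head?_append_of_ne_nil _ hRne] at ht
      exact List.mem_of_mem_head? ht
    refine hdom y hyX t ?_
    rintro rfl
    exact ((hRmem _).1 htR).2 hyX
  · have e1 : (l ++ (R ++ [x])).getLast (by simp) = x := by simp
    have e2 : (l ++ (R ++ [x])).head (by simp) ∈ l := by
      rw [List.head_append_of_ne_nil hlne]; exact List.head_mem _
    rw [e1]
    refine hdom x hx _ ?_
    intro h
    rw [← h, hlmem] at e2
    exact hxW e2

theorem exists_equiv_of_partition {V : Type*} [DecidableEq V] (P Q R : Finset V)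
    {p q r : ℕ} (hP : P.card = p) (hQ : Q.card = q) (hR : R.card = r)
    (hPQ : Disjoint P Q) (hPR : Disjoint P R) (hQR : Disjoint Q R)
    (hcov : ∀ v, v ∈ P ∨ v ∈ Q ∨ v ∈ R) :
    ∃ e : (Fin p ⊕ (Fin q ⊕ Fin r)) ≃ V, (∀ i, e (.inl i) ∈ P) ∧
      (∀ i, e (.inr (.inl i)) ∈ Q) ∧ ∀ i, e (.inr (.inr i)) ∈ R := by
  set eP := (Finset.equivFinOfCardEq hP).symm
  set eQ := (Finset.equivFinOfCardEq hQ).symm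
  set eR := (Finset.equivFinOfCardEq hR).symm
  set f : Fin p ⊕ (Fin q ⊕ Fin r) → V := Sum.elim (fun i => (eP i : V))
    (Sum.elim (fun i => (eQ i : V)) fun i => (eR i : V)) with hf
  have hbij : Function.Bijective f := by
    constructor
    · refine Function.Injective.sumElim (Subtype.val_injective.comp eP.injective)
        (Function.Injective.sumElim (Subtype.val_injective.comp eQ.injective)
          (Subtype.val_injective.comp eR.injective) fun a b h => ?_) ?_
      · exact Finset.disjoint_left.1 hQR (eQ a).2 (h ▸ (eR b).2)
      · rintro a (b | b) h
        · exact Finset.disjoint_left.1 hPQ (eP a).2 (by rw [h]; exact (eQ b).2)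
        · exact Finset.disjoint_left.1 hPR (eP a).2 (by rw [h]; exact (eR b).2)
    · intro v
      rcases hcov v with h | h | h
      · exact ⟨.inl (eP.symm ⟨v, h⟩), by simp [hf]⟩
      · exact ⟨.inr (.inl (eQ.symm ⟨v, h⟩)), by simp [hf]⟩
      · exact ⟨.inr (.inr (eR.symm ⟨v, h⟩)), by simp [hf]⟩
  exact ⟨Equiv.ofBijective f hbij, fun i => (eP i).2, fun i => (eQ i).2, fun i => (eR i).2⟩

/-- If `A` consists of `k` vertices of degree `k`, its complement is a clique, and every clique
vertex is adjacent to all of `A` (when in `X`) or to none of it, then the size of `X` decides the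
graph: `1` gives `graphL n k`, `k` gives `graphN n k`, and any other size a Hamiltonian graph. -/
theorem isHamiltonian_or_iso {V : Type*} [Fintype V] [DecidableEq V]
    (G : SimpleGraph V) [DecidableRel G.Adj] (n k : ℕ) (hcard : Fintype.card V = n)
    (hk : 1 ≤ k) (h1 : 6 * k + 5 ≤ n) (A X : Finset V) (hA : A.card = k)
    (hAdeg : ∀ a ∈ A, G.degree a = k)
    (hC : ∀ x, x ∉ A → ∀ y, y ∉ A → x ≠ y → G.Adj x y) (hXA : ∀ x ∈ X, x ∉ A)
    (hAX : ∀ c, c ∉ A → ∀ a ∈ A, (G.Adj c a ↔ c ∈ X)) :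
    G.IsHamiltonian ∨ Nonempty (G ≃g graphL n k) ∨ Nonempty (G ≃g graphN n k) := by
  have hAX' : ∀ c, c ∉ A → ∀ a ∈ A, (G.Adj a c ↔ c ∈ X) := fun c hc a ha => by
    rw [G.adj_comm]; exact hAX c hc a ha
  have hXN : ∀ a ∈ A, X ⊆ G.neighborFinset a := fun a ha x hx => by
    rw [SimpleGraph.mem_neighborFinset]; exact (hAX' x (hXA x hx) a ha).2 hx
  have hNX : ∀ a ∈ A, G.neighborFinset a ⊆ A.erase a ∪ X := by
    intro a ha t ht
    rw [SimpleGraph.mem_neighborFinset] at ht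
    by_cases htA : t ∈ A
    · exact Finset.mem_union_left _ (Finset.mem_erase.2 ⟨ht.ne', htA⟩)
    · exact Finset.mem_union_right _ ((hAX' t htA a ha).1 ht)
  have hdegc : ∀ a ∈ A, (G.neighborFinset a).card = k := fun a ha => by
    rw [SimpleGraph.card_neighborFinset_eq_degree, hAdeg a ha]
  obtain ⟨a₀, ha₀⟩ : A.Nonempty := Finset.card_pos.1 (by omega)
  have hXk : X.card ≤ k := hdegc a₀ ha₀ ▸ Finset.card_le_card (hXN a₀ ha₀)
  have hErase : ∀ a ∈ A, (A.erase a ∪ X).card ≤ k - 1 + X.card := fun a ha =>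
    (Finset.card_union_le _ _).trans (by rw [Finset.card_erase_of_mem ha, hA])
  have hX1 : 1 ≤ X.card := by
    have h2 := Finset.card_le_card (hNX a₀ ha₀)
    have h3 := hErase a₀ ha₀
    rw [hdegc a₀ ha₀] at h2
    omega
  have hXsub : X ⊆ Aᶜ := fun x hx => Finset.mem_compl.2 (hXA x hx)
  have hRcard : (Aᶜ \ X).card = n - k - X.card := by
    rw [Finset.card_sdiff_of_subset hXsub, Finset.card_compl, hcard, hA]
  have dXA : Disjoint X A := Finset.disjoint_left.2 hXA
  have dXR : Disjoint X (Aᶜ \ X) := Finset.disjoint_sdiff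
  have dAR : Disjoint A (Aᶜ \ X) := Finset.disjoint_left.2 fun a ha h => by
    simp [ha] at h
  have hRA : ∀ r ∈ Aᶜ \ X, r ∉ A := fun r hr h => by simp [h] at hr
  have hRX : ∀ r ∈ Aᶜ \ X, r ∉ X := fun r hr h => by simp [h] at hr
  have hcov : ∀ v, v ∈ X ∨ v ∈ A ∨ v ∈ Aᶜ \ X := fun v => by
    simp only [Finset.mem_sdiff, Finset.mem_compl]; tauto
  rcases Nat.lt_or_ge 1 X.card with hX2 | hX2
  · rcases hXk.lt_or_eq with hlt | heq
    · exact Or.inl (isHamiltonian_of_two_le_card_lt G n k hcard h1 A X hA hAdeg hC hXA hAX hX2 hlt)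
    · -- the neighbourhood of each vertex of `A` is exactly `X`
      have hind : ∀ a ∈ A, ∀ b ∈ A, ¬ G.Adj a b := by
        intro a ha b hb hab
        have := Finset.eq_of_subset_of_card_le (hXN a ha) (by rw [hdegc a ha, heq])
        have hb' : b ∈ X := by rw [this, SimpleGraph.mem_neighborFinset]; exact hab
        exact hXA b hb' hb
      obtain ⟨e, eX, eR, eA⟩ := exists_equiv_of_partition X (Aᶜ \ X) A heq
        (show _ = n - 2 * k by rw [hRcard]; omega) hA dXR dXA dAR.symm
        (fun v => by have := hcov v; tauto)
      have hXall : ∀ i w, e (.inl i) ≠ w → G.Adj (e (.inl i)) w := fun i w hne => by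
        by_cases hw : w ∈ A
        · exact (hAX _ (hXA _ (eX i)) w hw).2 (eX i)
        · exact hC _ (hXA _ (eX i)) _ hw hne
      have hRAnot : ∀ i j, ¬ G.Adj (e (.inr (.inl i))) (e (.inr (.inr j))) := fun i j h =>
        hRX _ (eR i) ((hAX _ (hRA _ (eR i)) _ (eA j)).1 h)
      have hRR : ∀ i j, i ≠ j → G.Adj (e (.inr (.inl i))) (e (.inr (.inl j))) := fun i j hij =>
        hC _ (hRA _ (eR i)) _ (hRA _ (eR j)) (e.injective.ne (by simpa using hij))
      refine Or.inr (Or.inr ⟨RelIso.symm ⟨e, ?_⟩⟩)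
      rintro (i | i | i) (j | j | j)
      · simpa [graphN, graphJoin] using
          ⟨fun h hij => h.ne (by rw [hij]), fun h => hXall i _ (e.injective.ne (by simpa using h))⟩
      · simpa [graphN, graphJoin] using hXall i _ (e.injective.ne (by simp))
      · simpa [graphN, graphJoin] using hXall i _ (e.injective.ne (by simp))
      · simpa [graphN, graphJoin] using (hXall j _ (e.injective.ne (by simp))).symm
      · simpa [graphN, graphJoin] using ⟨fun h hij => h.ne (by rw [hij]), hRR i j⟩
      · simpa [graphN, graphJoin] using hRAnot i j
      · simpa [graphN, graphJoin] using (hXall j _ (e.injective.ne (by simp))).symm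
      · simpa [graphN, graphJoin] using fun h => hRAnot j i (SimpleGraph.Adj.symm h)
      · simpa [graphN, graphJoin] using hind _ (eA i) _ (eA j)
  · -- the neighbourhood of each `a ∈ A` is all of `(A \ {a}) ∪ X`
    have hX1' : X.card = 1 := by omega
    have hAA : ∀ a ∈ A, ∀ b ∈ A, a ≠ b → G.Adj a b := by
      intro a ha b hb hab
      have h2 := hErase a ha
      have := Finset.eq_of_subset_of_card_le (hNX a ha) (by rw [hdegc a ha]; omega)
      rw [← SimpleGraph.mem_neighborFinset, this]
      exact Finset.mem_union_left _ (Finset.mem_erase.2 ⟨hab.symm, hb⟩)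
    obtain ⟨e, eX, eA, eR⟩ := exists_equiv_of_partition X A (Aᶜ \ X) hX1' hA
      (show _ = n - k - 1 by rw [hRcard, hX1']) dXA dXR dAR hcov
    have hXall : ∀ i w, e (.inl i) ≠ w → G.Adj (e (.inl i)) w := fun i w hne => by
      by_cases hw : w ∈ A
      · exact (hAX _ (hXA _ (eX i)) w hw).2 (eX i)
      · exact hC _ (hXA _ (eX i)) _ hw hne
    have hRAnot : ∀ i j, ¬ G.Adj (e (.inr (.inr i))) (e (.inr (.inl j))) := fun i j h =>
      hRX _ (eR i) ((hAX _ (hRA _ (eR i)) _ (eA j)).1 h)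
    have hRR : ∀ i j, i ≠ j → G.Adj (e (.inr (.inr i))) (e (.inr (.inr j))) := fun i j hij =>
      hC _ (hRA _ (eR i)) _ (hRA _ (eR j)) (e.injective.ne (by simpa using hij))
    have hAA' : ∀ i j, i ≠ j → G.Adj (e (.inr (.inl i))) (e (.inr (.inl j))) := fun i j hij =>
      hAA _ (eA i) _ (eA j) (e.injective.ne (by simpa using hij))
    refine Or.inr (Or.inl ⟨RelIso.symm ⟨e, ?_⟩⟩)
    rintro (i | i | i) (j | j | j)
    · have : i = j := Subsingleton.elim _ _
      simp [graphL, graphJoin, this]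
    · simpa [graphL, graphJoin] using hXall i _ (e.injective.ne (by simp))
    · simpa [graphL, graphJoin] using hXall i _ (e.injective.ne (by simp))
    · simpa [graphL, graphJoin] using (hXall j _ (e.injective.ne (by simp))).symm
    · simpa [graphL, graphJoin] using ⟨fun h hij => h.ne (by rw [hij]), hAA' i j⟩
    · simpa [graphL, graphJoin] using fun h => hRAnot j i (SimpleGraph.Adj.symm h)
    · simpa [graphL, graphJoin] using (hXall j _ (e.injective.ne (by simp))).symm
    · simpa [graphL, graphJoin] using hRAnot i j
    · simpa [graphL, graphJoin] using ⟨fun h hij => h.ne (by rw [hij]), hRR i j⟩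

/-! ### Spectral condition for Hamiltonicity -/

theorem proposition1p2 {V : Type*} [Fintype V] [DecidableEq V]
    (G : SimpleGraph V) [DecidableRel G.Adj] (n k : ℕ) (hk : 1 ≤ k)
    (hcard : Fintype.card V = n)
    (hn : max ((k : ℝ) ^ 3 / 2 + (k : ℝ) + 5 / 2) (6 * (k : ℝ) + 5) ≤ (n : ℝ))
    (hdeg : k ≤ G.minDegree)
    (hspec : (n : ℝ) - (k : ℝ) - 1 ≤ graphSpectralRadius G) :
    G.IsHamiltonian ∨ Nonempty (G ≃g graphL n k) ∨ Nonempty (G ≃g graphN n k) := by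
  by_cases hG : G.IsHamiltonian
  · exact Or.inl hG
  obtain ⟨hn1, hn2⟩ := max_le_iff.1 hn
  have h1 : 6 * k + 5 ≤ n := by exact_mod_cast hn2
  have h2 : k ^ 3 + 2 * k + 5 ≤ 2 * n := by
    have : (k : ℝ) ^ 3 + 2 * k + 5 ≤ 2 * n := by linarith
    exact_mod_cast this
  have hGdeg : ∀ v, k ≤ G.degree v := fun v => hdeg.trans (G.minDegree_le_degree v)
  have hV : 3 ≤ Fintype.card V := by omega
  obtain ⟨H, hdec, hGH, hH, hore⟩ := exists_maximal_not_isHamiltonian hV hG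
  rw [hcard] at hore
  have hle : ∀ v, G.degree v ≤ H.degree v := fun v => SimpleGraph.degree_le_of_le hGH
  have hnc : ∃ u v, u ≠ v ∧ ¬ H.Adj u v := by
    by_contra! h
    have : H = ⊤ := by
      ext u v
      exact ⟨fun h' => h'.ne, fun h' => h u v h'⟩
    exact hH (this ▸ isHamiltonian_top hV)
  have hsum := (le_sum_degree_of_le_graphSpectralRadius G n k hcard h1 hGdeg hspec).trans
    (Finset.sum_le_sum fun v _ => (by exact_mod_cast hle v : (G.degree v : ℤ) ≤ H.degree v))
  obtain ⟨A, hA, hAdeg, hC⟩ := exists_compl_clique H n k hcard hk h1 h2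
    (fun v => (hGdeg v).trans (hle v)) hore hnc hsum
  obtain ⟨a₀, ha₀⟩ : A.Nonempty := Finset.card_pos.1 (by omega)
  set X := Aᶜ.filter fun c => ∃ a ∈ A, H.Adj c a with hX
  have hXA : ∀ x ∈ X, x ∉ A := fun x hx => Finset.mem_compl.1 (Finset.mem_filter.1 hx).1
  -- a clique vertex with a neighbour in `A` has degree at least `n - k`, so by Ore's condition it
  -- is adjacent to every vertex of `A`
  have hAX : ∀ c, c ∉ A → ∀ a ∈ A, (H.Adj c a ↔ c ∈ X) := by
    intro c hc a ha
    refine ⟨fun h => Finset.mem_filter.2 ⟨Finset.mem_compl.2 hc, a, ha, h⟩, fun h => ?_⟩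
    obtain ⟨-, b, hb, hcb⟩ := Finset.mem_filter.1 h
    by_contra hca
    have hlt := hore c a (fun h => hc (h ▸ ha)) hca
    have hsub : insert b (Aᶜ.erase c) ⊆ H.neighborFinset c := by
      intro t ht
      rw [SimpleGraph.mem_neighborFinset]
      rcases Finset.mem_insert.1 ht with rfl | ht
      · exact hcb
      · obtain ⟨h3, h4⟩ := Finset.mem_erase.1 ht
        exact hC c hc t (Finset.mem_compl.1 h4) h3.symm
    have hcd := Finset.card_le_card hsub
    rw [Finset.card_insert_of_notMem (by simp [hb]),
      Finset.card_erase_of_mem (Finset.mem_compl.2 hc), Finset.card_compl, hcard, hA,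
      SimpleGraph.card_neighborFinset_eq_degree] at hcd
    rw [hAdeg a ha] at hlt
    omega
  have hXk : X.card ≤ k := by
    rw [← hAdeg a₀ ha₀, ← SimpleGraph.card_neighborFinset_eq_degree]
    refine Finset.card_le_card fun x hx => ?_
    rw [SimpleGraph.mem_neighborFinset]
    exact ((hAX x (hXA x hx) a₀ ha₀).2 hx).symm
  -- at a vertex of `A`, the minimum degree condition leaves no room for missing edges
  have hAN : ∀ a ∈ A, ∀ w, H.Adj a w → G.Adj a w := by
    intro a ha w haw
    have : G.neighborFinset a = H.neighborFinset a := by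
      refine Finset.eq_of_subset_of_card_le (fun t ht => ?_) ?_
      · rw [SimpleGraph.mem_neighborFinset] at ht ⊢; exact hGH ht
      · rw [SimpleGraph.card_neighborFinset_eq_degree, SimpleGraph.card_neighborFinset_eq_degree,
          hAdeg a ha]
        exact hGdeg a
    rw [← SimpleGraph.mem_neighborFinset, this, SimpleGraph.mem_neighborFinset]
    exact haw
  have hGC : ∀ x, x ∉ A → ∀ y, y ∉ A → x ≠ y → G.Adj x y := by
    intro x hx y hy hxy
    by_contra hadj
    refine absurd hspec (not_le.2 (graphSpectralRadius_lt_of_not_adj G n k hcard hk h1 h2 A X hA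
      hXk (fun a ha => (hle a).trans (hAdeg a ha).le) (fun c hc hcX a ha h => ?_) hx hy hxy hadj))
    exact hcX ((hAX c hc a ha).1 (hGH h))
  have hEq : G = H := by
    refine le_antisymm hGH fun x y hxy => ?_
    by_cases hx : x ∈ A
    · exact hAN x hx y hxy
    · by_cases hy : y ∈ A
      · exact (hAN y hy x hxy.symm).symm
      · exact hGC x hx y hy hxy.ne
  rw [hEq]
  exact isHamiltonian_or_iso H n k hcard hk h1 A X hA hAdeg hC hXA hAX
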